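/- Let $\Omega\subset\mathbb R^n$, $n\in\{2,3\}$, be a bounded domain with Lipschitz boundary. Put $L^\infty_+(\Omega)=\{w\in L^\infty(\Omega):\operatorname{ess\,inf}w>0\}$ and $L^2_\diamond(\partial\Omega)=\{w\in L^2(\partial\Omega):\langle w,1\rangle_{L^2(\partial\Omega)}=0\}$. For $\gamma\in L^\infty_+(\Omega)$ let $\Lambda(\gamma)\in\mathcal L(L^2_\diamond(\partial\Omega))$ be the Neumann-to-Dirichlet map $f\mapsto u|_{\partial\Omega}$, where $u\in H^1(\Omega)$ is the weak solution of $\nabla\cdot(\gamma\nabla u)=0$ in $\Omega$, $\nu\cdot\gamma\nabla u=f$ on $\partial\Omega$, with $\langle u|_{\partial\Omega},1\rangle_{L^2(\partial\Omega)}=0$. Let $\gamma=\gamma_0+\kappa\chi_D$, where $\gamma_0\in C^\infty(\overline\Omega)\cap L^\infty_+(\Omega)$, $\kappa\in L^\infty_+(\Omega)$ and $D$ is open with $\overline D\subseteq\Omega$, and let $\beta>0$ be a constant. Let $\{\Lambda_h(\eta)\}_{h>0}$, $\eta\in L^\infty_+(\Omega)$, be compact self-adjoint operators on $L^2_\diamond(\partial\Omega)$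 such that $$\|\Lambda(\eta)-\Lambda_h(\eta)\|_{\mathcal L(L^2_\diamond(\partial\Omega))}\le\omega(h)\,\|\eta\|_{L^\infty(\Omega)}\quad\text{for all }h>0,\ \eta\in L^\infty_+(\Omega),\qquad \lim_{h\to0}\omega(h)=0,$$ with $\omega$ independent of $\eta$. Let $\{N^\delta\}_{\delta>0}$ be compact self-adjoint operators on $L^2_\diamond(\partial\Omega)$ with $\|N^\delta\|\le\delta$, and let $\Lambda_h^\delta(\gamma)=\Lambda_h(\gamma)+N^\delta$. For open $B\subseteq\Omega$ put $$T(B)=\Lambda(\gamma_0+\beta\chi_B)-\Lambda(\gamma),\quad T_h(B)=\Lambda_h(\gamma_0+\beta\chi_B)-\Lambda_h(\gamma),\quad T_h^\delta(B)=\Lambda_h(\gamma_0+\beta\chi_B)-\Lambda_h^\delta(\gamma).$$ For an operator-valued map $S$ of this kind and $a\in\mathbb R$ let $$\mathcal M_a(S)=\{B\subseteq\Omega\text{ open ball}: S(B)+a\,\mathrm{Id}\ge0\},$$ where $\ge0$ means positive semidefinite, and let $\sigma$ denote the spectrum. Suppose that the regularization parameter $\alpha=\alpha(h,\delta)\in\mathbb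 R$ satisfies $$\delta-\alpha(h,\delta)\le\inf_{B\in\mathcal M_0(T)}\inf\sigma(T_h(B))\ \text{ for all }h,\delta>0\qquad\text{and}\qquad\lim_{h,\delta\to0}\alpha(h,\delta)=0,$$ where the infimum over the empty set is $+\infty$. Then for every $\lambda>0$ there is an $\varepsilon_\lambda>0$ such that $$\mathcal M_0(T)\subseteq\mathcal M_{\alpha(h,\delta)}(T_h^\delta)\subseteq\mathcal M_\lambda(T)\qquad\text{for all }h,\delta\in(0,\varepsilon_\lambda].$$ -/

import Mathlib

open MeasureTheory Filter Topology
open scoped ContDiff ENNReal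

namespace EIT

/-- The Euclidean space of dimension `n`. -/
abbrev Space (n : ℕ) : Type := EuclideanSpace ℝ (Fin n)

/-- A bounded domain with Lipschitz-regular boundary: a bounded, connected (hence nonempty) open
set which, near each of its boundary points and in a suitable rotated coordinate system, is the
region above the graph of a Lipschitz function. Here `e` is the "vertical" direction, and `ψ` is a
function of the component orthogonal to `e`. -/
structure IsLipschitzDomain {n : ℕ} (Ω : Set (Space n)) : Prop where
  isOpen : IsOpen Ω
  isConnected : IsConnected Ω
  isBounded : Bornology.IsBounded Ω
  lipschitz_boundary : ∀ x ∈ frontier Ω, ∃ e : Space n, ‖e‖ = 1 ∧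
    ∃ (K : NNReal) (ψ : (Submodule.span ℝ {e})ᗮ → ℝ), LipschitzWith K ψ ∧
      ∃ U ∈ 𝓝 x, ∀ y ∈ U,
        (y ∈ Ω ↔ ψ ((Submodule.span ℝ {e})ᗮ.orthogonalProjectionOnto y) < inner ℝ e y)

/-- Lebesgue measure on `Ω`. -/
noncomputable abbrev vol {n : ℕ} (Ω : Set (Space n)) : Measure (Space n) :=
  (volume : Measure (Space n)).restrict Ω

/-- Surface measure on the boundary of `Ω`: the `(n - 1)`-dimensional Hausdorff measure, with the
normalization that agrees with Lebesgue measure on `(n - 1)`-dimensional planes. -/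
noncomputable abbrev surfaceMeasure {n : ℕ} (Ω : Set (Space n)) : Measure (Space n) :=
  (Measure.euclideanHausdorffMeasure (n - 1) : Measure (Space n)).restrict (frontier Ω)

/-- `L²(∂Ω)`. -/
noncomputable abbrev BoundaryL2 {n : ℕ} (Ω : Set (Space n)) : Type :=
  Lp ℝ 2 (surfaceMeasure Ω)

/-- `L²_⋄(∂Ω)`, the subspace of those `w` in `L²(∂Ω)` with `⟨w, 1⟩ = 0`: the orthogonal complement
of (the line spanned by) the class of the constant function `1`. -/
noncomputable def L2Diamond {n : ℕ} (Ω : Set (Space n)) : Submodule ℝ (BoundaryL2 Ω) :=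
  (Submodule.span ℝ {c : BoundaryL2 Ω | (c : Space n → ℝ) =ᵐ[surfaceMeasure Ω] fun _ => 1})ᗮ

/-- `L²_⋄(∂Ω)` is a Hilbert space, being a closed subspace of `L²(∂Ω)`. -/
noncomputable instance {n : ℕ} (Ω : Set (Space n)) : CompleteSpace (L2Diamond Ω) :=
  inferInstanceAs (CompleteSpace
    (Submodule.span ℝ
      {c : BoundaryL2 Ω | (c : Space n → ℝ) =ᵐ[surfaceMeasure Ω] fun _ => 1})ᗮ)

/-- The space `𝓛(L²_⋄(∂Ω))` of bounded linear operators. -/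
abbrev BoundaryOp {n : ℕ} (Ω : Set (Space n)) : Type := L2Diamond Ω →L[ℝ] L2Diamond Ω

/-- `γ ∈ L^∞_+(Ω)`: `γ` is essentially bounded on `Ω` with positive essential infimum. (Elements
of `L^∞(Ω)` are represented by functions; only their values on `Ω`, up to null sets, matter.) -/
structure LInftyPos {n : ℕ} (Ω : Set (Space n)) (γ : Space n → ℝ) : Prop where
  memLp : MemLp γ ∞ (vol Ω)
  pos : ∃ c : ℝ, 0 < c ∧ ∀ᵐ x ∂(vol Ω), c ≤ γ x

/-- The norm of `L^∞(Ω)`. -/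
noncomputable def normLInfty {n : ℕ} (Ω : Set (Space n)) (γ : Space n → ℝ) : ℝ :=
  (eLpNorm γ ∞ (vol Ω)).toReal

/-- `u` belongs to `H¹(Ω)` and has the weak gradient `G`. -/
structure InH1 {n : ℕ} (Ω : Set (Space n)) (u : Space n → ℝ) (G : Space n → Space n) : Prop where
  memLp : MemLp u 2 (vol Ω)
  memLp_grad : MemLp G 2 (vol Ω)
  weak_grad : ∀ φ : Space n → ℝ, ContDiff ℝ ∞ φ → HasCompactSupport φ → tsupport φ ⊆ Ω →
    ∀ v : Space n, ∫ x in Ω, u x * fderiv ℝ φ x v = - ∫ x in Ω, inner ℝ (G x) v * φ x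

/-- `g ∈ L²(∂Ω)` is the trace `u|_{∂Ω}` of the `H¹(Ω)`-function `u` with weak gradient `G`.
The trace operator is the continuous extension to `H¹(Ω)` of the restriction `φ ↦ φ|_{∂Ω}` of
functions `φ` that are smooth up to the boundary. -/
def IsTrace {n : ℕ} (Ω : Set (Space n)) (u : Space n → ℝ) (G : Space n → Space n)
    (g : BoundaryL2 Ω) : Prop :=
  ∃ φ : ℕ → Space n → ℝ, (∀ k, ContDiff ℝ ∞ (φ k)) ∧
    Tendsto (fun k => eLpNorm (fun x => φ k x - u x) 2 (vol Ω)) atTop (𝓝 0) ∧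
    Tendsto (fun k => eLpNorm (fun x => gradient (φ k) x - G x) 2 (vol Ω)) atTop (𝓝 0) ∧
    Tendsto (fun k => eLpNorm (fun x => φ k x - g x) 2 (surfaceMeasure Ω)) atTop (𝓝 0)

/-- `u` (with weak gradient `G`) is a weak solution in `H¹(Ω)` of `∇·(γ∇u) = 0` in `Ω`,
`ν·γ∇u = f` on `∂Ω`: one has `∫_Ω γ ∇u·∇w dx = ⟨f, w|_{∂Ω}⟩` for all `w ∈ H¹(Ω)`. -/
structure IsWeakSolution {n : ℕ} (Ω : Set (Space n)) (γ : Space n → ℝ) (f : L2Diamond Ω)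
    (u : Space n → ℝ) (G : Space n → Space n) : Prop where
  inH1 : InH1 Ω u G
  weak_eq : ∀ (w : Space n → ℝ) (W : Space n → Space n) (t : BoundaryL2 Ω),
    InH1 Ω w W → IsTrace Ω w W t →
      ∫ x in Ω, γ x * inner ℝ (G x) (W x) = inner ℝ (f : BoundaryL2 Ω) t

/-- `A` maps each `f ∈ L²_⋄(∂Ω)` to the trace `u|_{∂Ω}` of the weak solution `u` of the Neumann
problem with conductivity `γ` and datum `f`, normalized by `u|_{∂Ω} ∈ L²_⋄(∂Ω)`. -/
def IsNDMap {n : ℕ} (Ω : Set (Space n)) (γ : Space n → ℝ) (A : BoundaryOp Ω) : Prop :=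
  ∀ f : L2Diamond Ω, ∃ (u : Space n → ℝ) (G : Space n → Space n),
    IsWeakSolution Ω γ f u G ∧ IsTrace Ω u G (A f : BoundaryL2 Ω)

open Classical in
/-- The Neumann-to-Dirichlet map `Λ(γ) ∈ 𝓛(L²_⋄(∂Ω))`. For a bounded Lipschitz domain and
`γ ∈ L^∞_+(Ω)` there is exactly one bounded operator with the property `IsNDMap` (Lax-Milgram);
for other arguments, which do not occur, the value `0` may be returned. -/
noncomputable def ndMap {n : ℕ} (Ω : Set (Space n)) (γ : Space n → ℝ) : BoundaryOp Ω :=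
  if h : ∃ A : BoundaryOp Ω, IsNDMap Ω γ A then h.choose else 0

/-- `γ = γ₀ + κ χ_D` is a conductivity with the positive inclusion `D` and jump `κ` with respect
to the background conductivity `γ₀`, which is smooth up to the boundary. -/
structure IsInclusion {n : ℕ} (Ω : Set (Space n)) (γ₀ κ : Space n → ℝ) (D : Set (Space n))
    (γ : Space n → ℝ) : Prop where
  smooth : ContDiffOn ℝ ∞ γ₀ (closure Ω)
  background_pos : LInftyPos Ω γ₀
  jump_pos : LInftyPos Ω κ
  isOpen : IsOpen D
  closure_subset : closure D ⊆ Ω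
  eq : γ = fun x => γ₀ x + D.indicator κ x

/-- The test conductivity `γ₀ + β χ_B`. -/
noncomputable def testConductivity {n : ℕ} (γ₀ : Space n → ℝ) (β : ℝ) (B : Set (Space n)) :
    Space n → ℝ :=
  fun x => γ₀ x + β * B.indicator (fun _ => 1) x

/-- `T(B) = L(γ₀ + β χ_B) - A`, for a forward map `L` and a (possibly noisy) datum `A`. -/
noncomputable def testOp {n : ℕ} {Ω : Set (Space n)} (L : (Space n → ℝ) → BoundaryOp Ω)
    (A : BoundaryOp Ω) (γ₀ : Space n → ℝ) (β : ℝ) (B : Set (Space n)) : BoundaryOp Ω :=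
  L (testConductivity γ₀ β B) - A

/-- `𝓜_α(T)`: the collection of the open balls `B ⊆ Ω` with `T(B) + α Id ≥ 0`. -/
def ballCollection {n : ℕ} {Ω : Set (Space n)} (T : Set (Space n) → BoundaryOp Ω) (α : ℝ) :
    Set (Set (Space n)) :=
  {B | (∃ (c : Space n) (r : ℝ), 0 < r ∧ B = Metric.ball c r) ∧ B ⊆ Ω ∧
    (T B + α • ContinuousLinearMap.id ℝ (L2Diamond Ω)).IsPositive}

/-- `inf σ(S)` for a (self-adjoint) operator `S`. -/
noncomputable def infSpectrum {n : ℕ} {Ω : Set (Space n)} (S : BoundaryOp Ω) : ℝ :=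
  sInf (spectrum ℝ S)

end EIT

/-!
The two inclusions are comparisons of quadratic forms on the real Hilbert space `L²_⋄(∂Ω)`; nothing
about the Neumann problem itself enters beyond the approximation of `Λ(η)` by `Λ_h(η)`.

*First inclusion.* A bounded self-adjoint operator satisfies `⟪S x, x⟫ ≥ (inf σ(S)) ‖x‖²`
(`inner_apply_self_ge_infSpectrum`). For `B ∈ 𝓜₀(T)` the choice of `α` therefore gives
`T_h(B) ≥ δ - α`, and subtracting the noise, whose norm is at most `δ`, leaves `T_h^δ(B) ≥ -α`.

*Second inclusion.* If `T_h^δ(B) ≥ -α`, then `T(B) ≥ -α - δ - ‖T(B) - T_h(B)‖`. The last norm is at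
most `ω(h)` times a bound that does not depend on `B`, because `‖γ₀ + β χ_B‖ ≤ ‖γ₀‖ + β`
(`normLInfty_testConductivity_le`). So for small `h` and `δ` the right-hand side exceeds `-λ`.
Self-adjointness of `T(B)`, which is part of `T(B) + λ Id ≥ 0`, holds since `Λ(η)` is the norm limit
of the self-adjoint operators `Λ_h(η)` (`isSelfAdjoint_ndMap_of_approx`).
-/

section Operator

variable {E : Type*} [NormedAddCommGroup E] [InnerProductSpace ℝ E]

theorem abs_inner_apply_self_le (S : E →L[ℝ] E) (x : E) :
    |inner ℝ (S x) x| ≤ ‖S‖ * ‖x‖ ^ 2 := by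
  calc |inner ℝ (S x) x| ≤ ‖S x‖ * ‖x‖ := abs_real_inner_le_norm _ _
    _ ≤ ‖S‖ * ‖x‖ * ‖x‖ := by gcongr; exact S.le_opNorm x
    _ = ‖S‖ * ‖x‖ ^ 2 := by ring

/-- `norm_sub_le` for operators on an abstract space. Instance unification does not see the
operator norm on `EIT.BoundaryOp Ω` as a case of the general lemma. -/
theorem norm_operator_sub_le (S R : E →L[ℝ] E) : ‖S - R‖ ≤ ‖S‖ + ‖R‖ :=
  norm_sub_le S R

variable [CompleteSpace E]

theorem isPositive_add_smul_id_iff {S : E →L[ℝ] E} (hS : IsSelfAdjoint S) (a : ℝ) :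
    (S + a • ContinuousLinearMap.id ℝ E).IsPositive ↔
      ∀ x, -a * ‖x‖ ^ 2 ≤ inner ℝ (S x) x := by
  have hsa : IsSelfAdjoint (S + a • ContinuousLinearMap.id ℝ E) :=
    hS.add ((IsSelfAdjoint.all a).smul (IsSelfAdjoint.one (E →L[ℝ] E)))
  rw [ContinuousLinearMap.isPositive_iff', and_iff_right hsa]
  refine forall_congr' fun x => ?_
  have : inner ℝ ((S + a • ContinuousLinearMap.id ℝ E) x) x =
      inner ℝ (S x) x + a * ‖x‖ ^ 2 := by
    simp [inner_add_left, real_inner_smul_left]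
  rw [this]
  constructor <;> intro h <;> linarith

/-- The infimum of the spectrum of a self-adjoint operator is a lower bound of its quadratic form.
Shifting by `‖S‖` turns this into the equality of norm and spectral radius: `‖S‖ - S` has
its spectrum in `[0, ‖S‖ - inf σ(S)]`, hence norm at most `‖S‖ - inf σ(S)`. -/
theorem sInf_spectrum_mul_le_inner_apply_self {S : E →L[ℝ] E} (hS : IsSelfAdjoint S) (x : E) :
    sInf (spectrum ℝ S) * ‖x‖ ^ 2 ≤ inner ℝ (S x) x := by
  cases subsingleton_or_nontrivial E
  · simp [Subsingleton.elim x 0]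
  set M := ‖S‖
  set m := sInf (spectrum ℝ S)
  have hbound : ∀ μ ∈ spectrum ℝ S, |μ| ≤ M := fun μ hμ => spectrum.norm_le_norm_of_mem hμ
  have hbdd : BddBelow (spectrum ℝ S) := ⟨-M, fun μ hμ => (abs_le.1 (hbound μ hμ)).1⟩
  have hmM : m ≤ M := by
    rcases (spectrum ℝ S).eq_empty_or_nonempty with h | ⟨μ, hμ⟩
    · simp [m, h, M]
    · exact (csInf_le hbdd hμ).trans (abs_le.1 (hbound μ hμ)).2
  set R : E →L[ℝ] E := algebraMap ℝ (E →L[ℝ] E) M - S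
  have hR : IsSelfAdjoint R :=
    ((IsSelfAdjoint.all M).algebraMap (E →L[ℝ] E)).sub hS
  have hRnorm : ‖R‖ ≤ M - m := by
    have hrad : spectralRadius ℝ R ≤ ((M - m).toNNReal : ℝ≥0∞) := by
      refine iSup₂_le fun μ hμ => ?_
      have hμ' : M - μ ∈ spectrum ℝ S := by
        rw [spectrum.mem_iff] at hμ ⊢
        convert (IsUnit.neg_iff _).not.2 hμ using 2
        simp only [R, map_sub]
        abel
      have h1 := csInf_le hbdd hμ'
      have h2 := abs_le.1 (hbound _ hμ')
      rw [ENNReal.coe_le_coe, ← NNReal.coe_le_coe, Real.coe_toNNReal _ (by linarith), coe_nnnorm,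
        Real.norm_eq_abs, abs_le]
      constructor <;> linarith
    rw [ContinuousLinearMap.spectralRadius_eq_nnnorm R hR, ENNReal.coe_le_coe,
      ← NNReal.coe_le_coe, Real.coe_toNNReal _ (by linarith)] at hrad
    exact hrad
  have h1 : inner ℝ (R x) x = M * ‖x‖ ^ 2 - inner ℝ (S x) x := by
    simp [R, inner_sub_left, Algebra.algebraMap_eq_smul_one, real_inner_smul_left]
  have h2 := (abs_le.1 (abs_inner_apply_self_le R x)).2
  have h3 := mul_le_mul_of_nonneg_right hRnorm (sq_nonneg ‖x‖)
  linarith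

/-- `IsSelfAdjoint.sub` for operators on an abstract Hilbert space. As for `norm_operator_sub_le`,
the general lemma does not unify with the star structure of `EIT.BoundaryOp Ω`. -/
theorem isSelfAdjoint_operator_sub {S R : E →L[ℝ] E} (hS : IsSelfAdjoint S)
    (hR : IsSelfAdjoint R) : IsSelfAdjoint (S - R) :=
  hS.sub hR

theorem isSelfAdjoint_of_tendsto_norm_sub {ι : Type*} {l : Filter ι} [l.NeBot] {A : E →L[ℝ] E}
    {L : ι → E →L[ℝ] E} (hL : ∀ᶠ i in l, IsSelfAdjoint (L i))
    (hlim : Tendsto (fun i => ‖A - L i‖) l (𝓝 0)) : IsSelfAdjoint A := by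
  have hlim' : Tendsto L l (𝓝 A) := by
    rw [tendsto_iff_norm_sub_tendsto_zero]
    simpa only [norm_sub_rev] using hlim
  exact (isClosed_eq continuous_star continuous_id).mem_of_tendsto hlim' hL

end Operator

namespace EIT

variable {n : ℕ} {Ω : Set (Space n)}

theorem inner_apply_self_ge_infSpectrum {S : BoundaryOp Ω} (hS : IsSelfAdjoint S)
    (x : L2Diamond Ω) : infSpectrum S * ‖x‖ ^ 2 ≤ inner ℝ (S x) x :=
  sInf_spectrum_mul_le_inner_apply_self hS x

theorem LInftyPos.add_nonneg {η ζ : Space n → ℝ} (hη : LInftyPos Ω η)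
    (hζ : MemLp ζ ∞ (vol Ω)) (hζ0 : ∀ᵐ x ∂(vol Ω), 0 ≤ ζ x) :
    LInftyPos Ω (fun x => η x + ζ x) := by
  obtain ⟨c, hc, hcη⟩ := hη.pos
  refine ⟨hη.memLp.add hζ, c, hc, ?_⟩
  filter_upwards [hcη, hζ0] with x h1 h2
  linarith

theorem IsInclusion.lInftyPos {γ₀ κ γ : Space n → ℝ} {D : Set (Space n)}
    (h : IsInclusion Ω γ₀ κ D γ) : LInftyPos Ω γ := by
  rw [h.eq]
  refine h.background_pos.add_nonneg (h.jump_pos.memLp.indicator h.isOpen.measurableSet) ?_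
  obtain ⟨c, hc, hcκ⟩ := h.jump_pos.pos
  filter_upwards [hcκ] with x hx
  exact Set.indicator_apply_nonneg fun _ => by linarith

theorem eLpNorm_const_mul_indicator_le {β : ℝ} (hβ : 0 ≤ β) (B : Set (Space n)) :
    eLpNorm (fun x => β * B.indicator (fun _ => (1 : ℝ)) x) ∞ (vol Ω) ≤ ENNReal.ofReal β := by
  rw [eLpNorm_exponent_top]
  refine eLpNormEssSup_le_of_ae_bound (Eventually.of_forall fun x => ?_)
  by_cases hx : x ∈ B <;> simp [hx, hβ, abs_of_nonneg]

theorem memLp_const_mul_indicator {β : ℝ} (hβ : 0 ≤ β) {B : Set (Space n)}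
    (hB : MeasurableSet B) :
    MemLp (fun x => β * B.indicator (fun _ => (1 : ℝ)) x) ∞ (vol Ω) :=
  ⟨((measurable_const.indicator hB).const_mul β).aestronglyMeasurable,
    (eLpNorm_const_mul_indicator_le hβ B).trans_lt ENNReal.ofReal_lt_top⟩

theorem LInftyPos.testConductivity {γ₀ : Space n → ℝ} (h : LInftyPos Ω γ₀) {β : ℝ} (hβ : 0 ≤ β)
    {B : Set (Space n)} (hB : MeasurableSet B) : LInftyPos Ω (testConductivity γ₀ β B) :=
  h.add_nonneg (memLp_const_mul_indicator hβ hB) <| Eventually.of_forall fun _ =>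
    mul_nonneg hβ (Set.indicator_apply_nonneg fun _ => zero_le_one)

/-- The bound does not depend on the test inclusion `B`. -/
theorem normLInfty_testConductivity_le {γ₀ : Space n → ℝ} (h : LInftyPos Ω γ₀) {β : ℝ}
    (hβ : 0 ≤ β) {B : Set (Space n)} (hB : MeasurableSet B) :
    normLInfty Ω (testConductivity γ₀ β B) ≤ normLInfty Ω γ₀ + β := by
  have hle : eLpNorm (EIT.testConductivity γ₀ β B) ∞ (vol Ω) ≤
      eLpNorm γ₀ ∞ (vol Ω) + ENNReal.ofReal β :=
    (eLpNorm_add_le h.memLp.1 (memLp_const_mul_indicator hβ hB).1 le_top).trans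
      (add_le_add_right (eLpNorm_const_mul_indicator_le hβ B) _)
  have := ENNReal.toReal_mono (ENNReal.add_ne_top.2 ⟨h.memLp.2.ne, ENNReal.ofReal_ne_top⟩) hle
  rwa [ENNReal.toReal_add h.memLp.2.ne ENNReal.ofReal_ne_top, ENNReal.toReal_ofReal hβ] at this

theorem isSelfAdjoint_ndMap_of_approx {η : Space n → ℝ} {L : ℝ → BoundaryOp Ω} {om : ℝ → ℝ}
    (hL : ∀ h > 0, IsSelfAdjoint (L h))
    (happrox : ∀ h > 0, ‖ndMap Ω η - L h‖ ≤ om h * normLInfty Ω η)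
    (hom : Tendsto om (𝓝[>] 0) (𝓝 0)) : IsSelfAdjoint (ndMap Ω η) := by
  refine isSelfAdjoint_of_tendsto_norm_sub (L := L) (l := 𝓝[>] 0) ?_ ?_
  · filter_upwards [self_mem_nhdsWithin] with h hh
    exact hL h hh
  · refine squeeze_zero' (Eventually.of_forall fun _ => ContinuousLinearMap.opNorm_nonneg _) ?_
      (by simpa using hom.mul_const (normLInfty Ω η))
    filter_upwards [self_mem_nhdsWithin] with h hh
    exact happrox h hh

end EIT

theorem theorem3p2 (n : ℕ) (hn : n = 2 ∨ n = 3)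
    (Ω : Set (EIT.Space n)) (hΩ : EIT.IsLipschitzDomain Ω)
    -- the conductivity with an inclusion, and the contrast of the test inclusions
    (γ₀ κ γ : EIT.Space n → ℝ) (D : Set (EIT.Space n)) (hγ : EIT.IsInclusion Ω γ₀ κ D γ)
    (β : ℝ) (hβ : 0 < β)
    -- the approximate forward models `Λ_h` and their error bound `ω(h)`
    (Λh : ℝ → (EIT.Space n → ℝ) → EIT.BoundaryOp Ω) (om : ℝ → ℝ)
    (hΛh_compact : ∀ h > 0, ∀ η, EIT.LInftyPos Ω η → IsCompactOperator (Λh h η))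
    (hΛh_selfAdjoint : ∀ h > 0, ∀ η, EIT.LInftyPos Ω η → IsSelfAdjoint (Λh h η))
    (hΛh_approx : ∀ h > 0, ∀ η, EIT.LInftyPos Ω η →
      ‖EIT.ndMap Ω η - Λh h η‖ ≤ om h * EIT.normLInfty Ω η)
    (hom : Tendsto om (𝓝[>] 0) (𝓝 0))
    -- the noise `N^δ`
    (N : ℝ → EIT.BoundaryOp Ω)
    (hN_compact : ∀ δ > 0, IsCompactOperator (N δ))
    (hN_selfAdjoint : ∀ δ > 0, IsSelfAdjoint (N δ))
    (hN_norm : ∀ δ > 0, ‖N δ‖ ≤ δ)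
    -- the operators `T`, `T_h` and `T_h^δ`
    (T : Set (EIT.Space n) → EIT.BoundaryOp Ω)
    (hT : T = EIT.testOp (EIT.ndMap Ω) (EIT.ndMap Ω γ) γ₀ β)
    (Th : ℝ → Set (EIT.Space n) → EIT.BoundaryOp Ω)
    (hTh : ∀ h, Th h = EIT.testOp (Λh h) (Λh h γ) γ₀ β)
    (Thδ : ℝ → ℝ → Set (EIT.Space n) → EIT.BoundaryOp Ω)
    (hThδ : ∀ h δ, Thδ h δ = EIT.testOp (Λh h) (Λh h γ + N δ) γ₀ β)
    -- the regularization parameter; the infimum is taken in the extended real numbers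
    (α : ℝ → ℝ → ℝ)
    (hα_le : ∀ h > 0, ∀ δ > 0, ((δ - α h δ : ℝ) : EReal) ≤
      ⨅ B ∈ EIT.ballCollection T 0, ((EIT.infSpectrum (Th h B) : ℝ) : EReal))
    (hα_lim : Tendsto (fun p : ℝ × ℝ => α p.1 p.2) (𝓝[>] 0 ×ˢ 𝓝[>] 0) (𝓝 0)) :
    ∀ lam : ℝ, 0 < lam → ∃ ε : ℝ, 0 < ε ∧ ∀ h ∈ Set.Ioc 0 ε, ∀ δ ∈ Set.Ioc 0 ε,
      EIT.ballCollection T 0 ⊆ EIT.ballCollection (Thδ h δ) (α h δ) ∧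
      EIT.ballCollection (Thδ h δ) (α h δ) ⊆ EIT.ballCollection T lam := by
  have hγpos := hγ.lInftyPos
  have htest : ∀ {B : Set (EIT.Space n)}, (∃ (c : EIT.Space n) (r : ℝ), 0 < r ∧
      B = Metric.ball c r) → MeasurableSet B := by
    rintro B ⟨c, r, -, rfl⟩
    exact measurableSet_ball
  have hΛ_selfAdjoint : ∀ η, EIT.LInftyPos Ω η → IsSelfAdjoint (EIT.ndMap Ω η) := fun η hη =>
    EIT.isSelfAdjoint_ndMap_of_approx (fun h hh => hΛh_selfAdjoint h hh η hη)
      (fun h hh => hΛh_approx h hh η hη) hom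
  have hThδ_eq : ∀ h δ B, Thδ h δ B = Th h B - N δ := fun h δ B => by
    rw [hThδ, hTh]
    simp only [EIT.testOp]
    abel
  have hTh_selfAdjoint : ∀ h > 0, ∀ B, MeasurableSet B → IsSelfAdjoint (Th h B) :=
    fun h hh B hB => by
      rw [hTh]
      exact isSelfAdjoint_operator_sub
        (hΛh_selfAdjoint h hh _ (hγ.background_pos.testConductivity hβ.le hB))
        (hΛh_selfAdjoint h hh _ hγpos)
  have hThδ_selfAdjoint : ∀ h > 0, ∀ δ > 0, ∀ B, MeasurableSet B → IsSelfAdjoint (Thδ h δ B) :=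
    fun h hh δ hδ B hB => by
      rw [hThδ_eq]
      exact isSelfAdjoint_operator_sub (hTh_selfAdjoint h hh B hB) (hN_selfAdjoint δ hδ)
  have hN_form : ∀ δ > 0, ∀ x, |inner ℝ (N δ x) x| ≤ δ * ‖x‖ ^ 2 := fun δ hδ x =>
    (abs_inner_apply_self_le (N δ) x).trans (by gcongr; exact hN_norm δ hδ)
  intro lam hlam
  set K : ℝ := EIT.normLInfty Ω γ₀ + β + EIT.normLInfty Ω γ
  have happrox : ∀ h > 0, ∀ B, MeasurableSet B → ‖T B - Th h B‖ ≤ |om h| * K := by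
    intro h hh B hB
    have hpos := hγ.background_pos.testConductivity hβ.le hB
    have h1 := hΛh_approx h hh _ hpos
    have h2 := hΛh_approx h hh _ hγpos
    have heq : T B - Th h B =
        (EIT.ndMap Ω (EIT.testConductivity γ₀ β B) - Λh h (EIT.testConductivity γ₀ β B)) -
          (EIT.ndMap Ω γ - Λh h γ) := by
      rw [hT, hTh]
      simp only [EIT.testOp]
      abel
    have h3 : om h * EIT.normLInfty Ω (EIT.testConductivity γ₀ β B) ≤
        |om h| * (EIT.normLInfty Ω γ₀ + β) :=
      mul_le_mul (le_abs_self _) (EIT.normLInfty_testConductivity_le hγ.background_pos hβ.le hB)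
        ENNReal.toReal_nonneg (abs_nonneg _)
    have h4 : om h * EIT.normLInfty Ω γ ≤ |om h| * EIT.normLInfty Ω γ :=
      mul_le_mul_of_nonneg_right (le_abs_self _) ENNReal.toReal_nonneg
    rw [heq]
    calc _ ≤ _ := norm_operator_sub_le _ _
      _ ≤ |om h| * (EIT.normLInfty Ω γ₀ + β) + |om h| * EIT.normLInfty Ω γ :=
        add_le_add (h1.trans h3) (h2.trans h4)
      _ = |om h| * K := by ring
  -- Each of the three errors (regularization, discretization, noise) may use up `lam / 3`.
  have hthird : 0 < lam / 3 := by linarith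
  have hα_ev : ∀ᶠ p : ℝ × ℝ in 𝓝[>] 0 ×ˢ 𝓝[>] 0, |α p.1 p.2| < lam / 3 := by
    simpa using hα_lim.abs.eventually_lt_const (by simpa using hthird)
  have hom_ev : ∀ᶠ h in 𝓝[>] (0 : ℝ), |om h| * K < lam / 3 :=
    (hom.abs.mul_const K).eventually_lt_const (by simpa using hthird)
  obtain ⟨P, hP, Q, hQ, hPQ⟩ := eventually_prod_iff.1 hα_ev
  obtain ⟨ε₁, hε₁, hε₁P⟩ := mem_nhdsGT_iff_exists_Ioc_subset.1 (hP.and hom_ev)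
  obtain ⟨ε₂, hε₂, hε₂Q⟩ := mem_nhdsGT_iff_exists_Ioc_subset.1 hQ
  refine ⟨min (min ε₁ ε₂) (lam / 3), lt_min (lt_min hε₁ hε₂) hthird, ?_⟩
  rintro h ⟨hh, hhε⟩ δ ⟨hδ, hδε⟩
  simp only [le_inf_iff] at hhε hδε
  obtain ⟨hPh, homh⟩ := hε₁P ⟨hh, hhε.1.1⟩
  have hαh : |α h δ| < lam / 3 := hPQ hPh (hε₂Q ⟨hδ, hδε.1.2⟩)
  constructor
  · rintro B hBT
    obtain ⟨hball, hBΩ, -⟩ := id hBT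
    refine ⟨hball, hBΩ, ?_⟩
    rw [isPositive_add_smul_id_iff (hThδ_selfAdjoint h hh δ hδ B (htest hball))]
    intro x
    have hinf : δ - α h δ ≤ EIT.infSpectrum (Th h B) :=
      EReal.coe_le_coe_iff.1 ((hα_le h hh δ hδ).trans (iInf₂_le B hBT))
    have h1 := EIT.inner_apply_self_ge_infSpectrum (hTh_selfAdjoint h hh B (htest hball)) x
    have h2 := mul_le_mul_of_nonneg_right hinf (sq_nonneg ‖x‖)
    have h3 := (abs_le.1 (hN_form δ hδ x)).2
    rw [hThδ_eq, sub_apply, inner_sub_left]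
    linarith
  · rintro B ⟨hball, hBΩ, hpos⟩
    have hB := htest hball
    have hT_selfAdjoint : IsSelfAdjoint (T B) := by
      rw [hT]
      exact isSelfAdjoint_operator_sub
        (hΛ_selfAdjoint _ (hγ.background_pos.testConductivity hβ.le hB))
        (hΛ_selfAdjoint _ hγpos)
    refine ⟨hball, hBΩ, ?_⟩
    rw [isPositive_add_smul_id_iff (hThδ_selfAdjoint h hh δ hδ B hB)] at hpos
    rw [isPositive_add_smul_id_iff hT_selfAdjoint]
    intro x
    have h1 := hpos x
    have h2 := (abs_le.1 (hN_form δ hδ x)).1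
    have h3 := (abs_le.1 (abs_inner_apply_self_le (T B - Th h B) x)).1
    rw [hThδ_eq, sub_apply, inner_sub_left] at h1
    rw [sub_apply, inner_sub_left] at h3
    have herr : α h δ + δ + ‖T B - Th h B‖ ≤ lam := by
      linarith [(abs_lt.1 hαh).2, happrox h hh B hB, hδε.2]
    have h4 := mul_le_mul_of_nonneg_right herr (sq_nonneg ‖x‖)
    linarith
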